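/- **Proposition.** An $F$-inverse monoid is an inverse monoid in which every class of the minimum group congruence $\sigma$ has a greatest element in the natural partial order; it is regarded as an algebra in the signature $(\cdot,1,{}^{-1},{}^{\mathfrak m})$, where $a^{\mathfrak m}$ is the greatest element of the $\sigma$-class of $a$. In this signature $F$-inverse monoids form a variety. For a set $Y$ and a set $R$ of pairs of terms over $Y$ in this signature, $\operatorname{FInv}\langle Y\mid R\rangle$ denotes the quotient of the free $F$-inverse monoid on $Y$ by the congruence generated by $R$; an $F$-inverse monoid is finitely presented if it is isomorphic to some $\operatorname{FInv}\langle Y\mid R\rangle$ with $Y$ and $R$ finite. Let $X$ be a nonempty set, and let $\operatorname{FIM}(X)$ be the free inverse monoid on $X$, regarded as an $F$-inverse monoid, with $(w_{\operatorname{FIM}(X)})^{\mathfrak m}=(\operatorname{red}(w))_{\operatorname{FIM}(X)}$ for every word $w\in(X\cup X^{-1})^*$, where $\operatorname{red}(w)$ is the freely reduced form of $w$ and $w_{\operatorname{FIM}(X)}$ is the element represented by $w$. Then $\operatorname{FIM}(X)$ is not finitely presented as an $F$-inverse monoid. -/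

import Mathlib

/-- An inverse monoid: a monoid in which every element `a` has a unique inverse `a⁻¹`,
i.e. a unique `b` with `a b a = a` and `b a b = b`. -/
class InverseMonoid (S : Type*) extends Monoid S, Inv S where
  mul_inv_mul : ∀ a : S, a * a⁻¹ * a = a
  inv_mul_inv : ∀ a : S, a⁻¹ * a * a⁻¹ = a⁻¹
  inv_unique : ∀ a b : S, a * b * a = a → b * a * b = b → b = a⁻¹

namespace InverseMonoid

/-- The natural partial order: `a ≤ b` iff `a = e b` for some idempotent `e`. -/
def NatLE {S : Type*} [InverseMonoid S] (a b : S) : Prop :=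
  ∃ e : S, IsIdempotentElem e ∧ a = e * b

/-- The minimum group congruence `σ`: two elements are related iff they have a common lower
bound in the natural partial order. -/
def Sigma {S : Type*} [InverseMonoid S] (a b : S) : Prop :=
  ∃ c : S, NatLE c a ∧ NatLE c b

section Equational

variable {S : Type*} [Monoid S] [Inv S]

/-- Consequence of the equational axioms for inverse monoids: idempotents are self-inverse. -/
theorem idem_eq_inv
    (h1 : ∀ a : S, a⁻¹⁻¹ = a) (h2 : ∀ a b : S, (a * b)⁻¹ = b⁻¹ * a⁻¹)
    (h3 : ∀ a : S, a * a⁻¹ * a = a)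
    (h4 : ∀ a b : S, (a * a⁻¹) * (b * b⁻¹) = (b * b⁻¹) * (a * a⁻¹))
    (e : S) (he : e * e = e) : e⁻¹ = e := by
  have h5 : e⁻¹ * e⁻¹ = e⁻¹ := by rw [← h2, he]
  have h6 : e⁻¹ * e * e⁻¹ = e⁻¹ := by
    have := h3 e⁻¹
    rwa [h1] at this
  have h7 := h4 e⁻¹ e
  rw [h1] at h7
  calc e⁻¹ = e⁻¹ * (e * e) * e⁻¹ := by rw [he, h6]
    _ = e⁻¹ * e * (e * e⁻¹) := by simp only [mul_assoc]
    _ = e * e⁻¹ * (e⁻¹ * e) := h7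
    _ = e * (e⁻¹ * e⁻¹) * e := by simp only [mul_assoc]
    _ = e := by rw [h5, h3]

/-- The equational axioms for inverse monoids imply that inverses are unique. -/
theorem unique_of_equations
    (h1 : ∀ a : S, a⁻¹⁻¹ = a) (h2 : ∀ a b : S, (a * b)⁻¹ = b⁻¹ * a⁻¹)
    (h3 : ∀ a : S, a * a⁻¹ * a = a)
    (h4 : ∀ a b : S, (a * a⁻¹) * (b * b⁻¹) = (b * b⁻¹) * (a * a⁻¹))
    (a b : S) (hab : a * b * a = a) (hba : b * a * b = b) : b = a⁻¹ := by
  have hcomm : ∀ e f : S, e * e = e → f * f = f → e * f = f * e := by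
    intro e f he hf
    have := h4 e f
    rwa [idem_eq_inv h1 h2 h3 h4 e he, idem_eq_inv h1 h2 h3 h4 f hf, he, hf] at this
  have h6 : a⁻¹ * a * a⁻¹ = a⁻¹ := by
    have := h3 a⁻¹
    rwa [h1] at this
  have i1 : (a * a⁻¹) * (a * a⁻¹) = a * a⁻¹ := by rw [← mul_assoc, h3]
  have i2 : (a⁻¹ * a) * (a⁻¹ * a) = a⁻¹ * a := by rw [← mul_assoc, h6]
  have i3 : (a * b) * (a * b) = a * b := by rw [← mul_assoc, hab]
  have i4 : (b * a) * (b * a) = b * a := by rw [← mul_assoc, hba]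
  calc b = b * (a * a⁻¹ * a) * b := by rw [h3, hba]
    _ = b * ((a * a⁻¹) * (a * b)) := by simp only [mul_assoc]
    _ = b * ((a * b) * (a * a⁻¹)) := by rw [hcomm _ _ i1 i3]
    _ = b * (a * b * a) * a⁻¹ := by simp only [mul_assoc]
    _ = b * a * (a⁻¹ * a * a⁻¹) := by rw [hab, h6]
    _ = ((b * a) * (a⁻¹ * a)) * a⁻¹ := by simp only [mul_assoc]
    _ = ((a⁻¹ * a) * (b * a)) * a⁻¹ := by rw [hcomm _ _ i4 i2]
    _ = a⁻¹ * (a * b * a) * a⁻¹ := by simp only [mul_assoc]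
    _ = a⁻¹ := by rw [hab, h6]

end Equational

section Lemmas

variable {S : Type*} [InverseMonoid S]

theorem idem_inv {e : S} (he : IsIdempotentElem e) : e⁻¹ = e :=
  (inv_unique e e (by rw [he.eq, he.eq]) (by rw [he.eq, he.eq])).symm

theorem mul_inv_idem (a : S) : IsIdempotentElem (a * a⁻¹) := by
  unfold IsIdempotentElem; rw [← mul_assoc, mul_inv_mul]

theorem inv_mul_idem (a : S) : IsIdempotentElem (a⁻¹ * a) := by
  unfold IsIdempotentElem; rw [← mul_assoc, inv_mul_inv]

theorem double_inv (a : S) : a⁻¹⁻¹ = a :=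
  (inv_unique a⁻¹ a (inv_mul_inv a) (mul_inv_mul a)).symm

/-- A product of two idempotents is an idempotent. -/
theorem idem_mul {e f : S} (he : IsIdempotentElem e) (hf : IsIdempotentElem f) :
    IsIdempotentElem (e * f) := by
  have he' : ∀ z : S, e * (e * z) = e * z := fun z => by rw [← mul_assoc, he.eq]
  have hf' : ∀ z : S, f * (f * z) = f * z := fun z => by rw [← mul_assoc, hf.eq]
  have hx1 := mul_inv_mul (e * f)
  have hx2 := inv_mul_inv (e * f)
  generalize hx : (e * f)⁻¹ = x at hx1 hx2
  have hx3 : f * x * e = x := by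
    rw [← hx]
    refine inv_unique _ _ ?_ ?_
    · rw [hx]
      simp only [mul_assoc] at hx1 ⊢
      rw [hf', he', hx1]
    · rw [hx]
      simp only [mul_assoc] at hx2 ⊢
      rw [he', hf']
      conv_rhs => rw [← hx2]
      simp only [mul_assoc]
  have hxi : IsIdempotentElem x := by
    unfold IsIdempotentElem
    calc x * x = (f * x * e) * (f * x * e) := by rw [hx3]
      _ = f * (x * (e * f) * x) * e := by simp only [mul_assoc]
      _ = x := by rw [hx2, hx3]
  have : e * f = x := by
    rw [← idem_inv hxi, ← hx, double_inv]
  rw [this]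
  exact hxi

/-- Idempotents of an inverse monoid commute. -/
theorem idem_comm {e f : S} (he : IsIdempotentElem e) (hf : IsIdempotentElem f) :
    e * f = f * e := by
  have hef := idem_mul he hf
  have hfe := idem_mul hf he
  have he' : ∀ z : S, e * (e * z) = e * z := fun z => by rw [← mul_assoc, he.eq]
  have hf' : ∀ z : S, f * (f * z) = f * z := fun z => by rw [← mul_assoc, hf.eq]
  have : f * e = (e * f)⁻¹ := by
    refine inv_unique _ _ ?_ ?_
    · have := hef.eq
      simp only [mul_assoc] at this ⊢
      rw [hf', he', this]
    · have := hfe.eq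
      simp only [mul_assoc] at this ⊢
      rw [he', hf', this]
  rw [this, idem_inv hef]

theorem mul_inv_rev' (a b : S) : (a * b)⁻¹ = b⁻¹ * a⁻¹ := by
  have h := idem_comm (mul_inv_idem b) (inv_mul_idem a)
  refine (inv_unique _ _ ?_ ?_).symm
  · calc a * b * (b⁻¹ * a⁻¹) * (a * b) = a * ((b * b⁻¹) * (a⁻¹ * a)) * b := by
          simp only [mul_assoc]
      _ = (a * a⁻¹ * a) * (b * b⁻¹ * b) := by rw [h]; simp only [mul_assoc]
      _ = a * b := by rw [mul_inv_mul, mul_inv_mul]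
  · calc b⁻¹ * a⁻¹ * (a * b) * (b⁻¹ * a⁻¹) = b⁻¹ * ((a⁻¹ * a) * (b * b⁻¹)) * a⁻¹ := by
          simp only [mul_assoc]
      _ = (b⁻¹ * b * b⁻¹) * (a⁻¹ * a * a⁻¹) := by rw [← h]; simp only [mul_assoc]
      _ = b⁻¹ * a⁻¹ := by rw [inv_mul_inv, inv_mul_inv]

theorem NatLE.refl (a : S) : NatLE a a := ⟨1, mul_one 1, (one_mul a).symm⟩

theorem NatLE.trans {a b c : S} (hab : NatLE a b) (hbc : NatLE b c) : NatLE a c := by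
  obtain ⟨e, he, rfl⟩ := hab
  obtain ⟨f, hf, rfl⟩ := hbc
  exact ⟨e * f, idem_mul he hf, (mul_assoc _ _ _).symm⟩

theorem NatLE.eq_mul {a b : S} (h : NatLE a b) : a = a * a⁻¹ * b := by
  obtain ⟨e, he, rfl⟩ := h
  have h' := idem_comm he (mul_inv_idem b)
  rw [mul_inv_rev', idem_inv he]
  calc e * b = e * e * (b * b⁻¹ * b) := by rw [he.eq, mul_inv_mul]
    _ = e * (e * (b * b⁻¹)) * b := by simp only [mul_assoc]
    _ = e * b * (b⁻¹ * e) * b := by rw [h']; simp only [mul_assoc]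

theorem NatLE.antisymm {a b : S} (hab : NatLE a b) (hba : NatLE b a) : a = b := by
  have h1 := hab.eq_mul
  have h2 := hba.eq_mul
  calc a = a * a⁻¹ * (b * b⁻¹ * a) := by rw [← h2, ← h1]
    _ = (a * a⁻¹ * (b * b⁻¹)) * a := by simp only [mul_assoc]
    _ = b * b⁻¹ * (a * a⁻¹ * a) := by
      rw [idem_comm (mul_inv_idem a) (mul_inv_idem b)]; simp only [mul_assoc]
    _ = b := by rw [mul_inv_mul, ← h2]

theorem natLE_insert_idem (u v : S) {e : S} (he : IsIdempotentElem e) :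
    NatLE (u * e * v) (u * v) := by
  have h := idem_comm he (inv_mul_idem u)
  have key : u * e * u⁻¹ * u = u * e := by
    calc u * e * u⁻¹ * u = u * (e * (u⁻¹ * u)) := by simp only [mul_assoc]
      _ = (u * u⁻¹ * u) * e := by rw [h]; simp only [mul_assoc]
      _ = u * e := by rw [mul_inv_mul]
  refine ⟨u * e * u⁻¹, ?_, ?_⟩
  · unfold IsIdempotentElem
    calc u * e * u⁻¹ * (u * e * u⁻¹) = (u * e * u⁻¹ * u) * e * u⁻¹ := by simp only [mul_assoc]
      _ = u * (e * e) * u⁻¹ := by rw [key]; simp only [mul_assoc]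
      _ = u * e * u⁻¹ := by rw [he.eq]
  · rw [← mul_assoc, key]

end Lemmas

end InverseMonoid

/-- An `F`-inverse monoid in the signature `(·, 1, ⁻¹, ᵐ)`: an inverse monoid in which every
`σ`-class has a greatest element in the natural partial order; `maxOf a` (written `aᵐ` on paper)
is the greatest element of the `σ`-class of `a`. -/
class FInverseMonoid (S : Type*) extends InverseMonoid S where
  maxOf : S → S
  sigma_maxOf : ∀ a : S, InverseMonoid.Sigma a (maxOf a)
  le_maxOf : ∀ a b : S, InverseMonoid.Sigma a b → InverseMonoid.NatLE b (maxOf a)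

/-- Terms over `Y` in the signature `(·, 1, ⁻¹, ᵐ)`. -/
inductive FTerm (Y : Type*) : Type _
  | var : Y → FTerm Y
  | one : FTerm Y
  | mul : FTerm Y → FTerm Y → FTerm Y
  | inv : FTerm Y → FTerm Y
  | maxOf : FTerm Y → FTerm Y

namespace FTerm

/-- The value of a term in an `F`-inverse monoid under an assignment of the variables. -/
def eval {Y S : Type*} [FInverseMonoid S] (φ : Y → S) : FTerm Y → S
  | var y => φ y
  | one => 1
  | mul s t => eval φ s * eval φ t
  | inv t => (eval φ t)⁻¹
  | maxOf t => FInverseMonoid.maxOf (eval φ t)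

/-- The least congruence on the term algebra that contains `R` and all instances of the defining
identities of the variety of `F`-inverse monoids. -/
inductive Congr {Y : Type*} (R : Set (FTerm Y × FTerm Y)) : FTerm Y → FTerm Y → Prop
  | of {s t : FTerm Y} : (s, t) ∈ R → Congr R s t
  | refl (s : FTerm Y) : Congr R s s
  | symm {s t : FTerm Y} : Congr R s t → Congr R t s
  | trans {s t r : FTerm Y} : Congr R s t → Congr R t r → Congr R s r
  | mul_congr {s s' t t' : FTerm Y} :
      Congr R s s' → Congr R t t' → Congr R (mul s t) (mul s' t')
  | inv_congr {s s' : FTerm Y} : Congr R s s' → Congr R (inv s) (inv s')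
  | maxOf_congr {s s' : FTerm Y} : Congr R s s' → Congr R (maxOf s) (maxOf s')
  | mul_assoc (s t r : FTerm Y) : Congr R (mul (mul s t) r) (mul s (mul t r))
  | one_mul (s : FTerm Y) : Congr R (mul one s) s
  | mul_one (s : FTerm Y) : Congr R (mul s one) s
  | inv_inv (s : FTerm Y) : Congr R (inv (inv s)) s
  | mul_inv_rev (s t : FTerm Y) : Congr R (inv (mul s t)) (mul (inv t) (inv s))
  | mul_inv_mul (s : FTerm Y) : Congr R (mul (mul s (inv s)) s) s
  | idem_comm (s t : FTerm Y) :
      Congr R (mul (mul s (inv s)) (mul t (inv t))) (mul (mul t (inv t)) (mul s (inv s)))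
  | le_maxOf (s : FTerm Y) : Congr R (mul (mul s (inv s)) (maxOf s)) s
  | maxOf_idem_mul (s t : FTerm Y) : Congr R (maxOf (mul (mul s (inv s)) t)) (maxOf t)

/-- The congruence as a setoid. -/
def setoid {Y : Type*} (R : Set (FTerm Y × FTerm Y)) : Setoid (FTerm Y) :=
  ⟨Congr R, Congr.refl, Congr.symm, Congr.trans⟩

/-- Soundness: congruent terms take the same value in every `F`-inverse monoid under every
assignment that satisfies the relations in `R`. -/
theorem Congr.eval_eq {Y S : Type*} [FInverseMonoid S] {R : Set (FTerm Y × FTerm Y)} (φ : Y → S)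
    (hR : ∀ p ∈ R, eval φ p.1 = eval φ p.2) {s t : FTerm Y} (h : Congr R s t) :
    eval φ s = eval φ t := by
  have hself : ∀ a : S, InverseMonoid.NatLE a (FInverseMonoid.maxOf a) := fun a =>
    FInverseMonoid.le_maxOf a a ⟨a, InverseMonoid.NatLE.refl a, InverseMonoid.NatLE.refl a⟩
  induction h with
  | of h => exact hR _ h
  | refl => rfl
  | symm _ ih => exact ih.symm
  | trans _ _ ih1 ih2 => exact ih1.trans ih2
  | mul_congr _ _ ih1 ih2 => simp only [eval, ih1, ih2]
  | inv_congr _ ih => simp only [eval, ih]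
  | maxOf_congr _ ih => simp only [eval, ih]
  | mul_assoc => exact _root_.mul_assoc _ _ _
  | one_mul => exact _root_.one_mul _
  | mul_one => exact _root_.mul_one _
  | inv_inv => exact InverseMonoid.double_inv _
  | mul_inv_rev => exact InverseMonoid.mul_inv_rev' _ _
  | mul_inv_mul => exact InverseMonoid.mul_inv_mul _
  | idem_comm =>
    exact InverseMonoid.idem_comm (InverseMonoid.mul_inv_idem _) (InverseMonoid.mul_inv_idem _)
  | le_maxOf => exact (hself _).eq_mul.symm
  | maxOf_idem_mul s t =>
    simp only [eval]
    generalize eval φ s = a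
    generalize eval φ t = b
    have hle : InverseMonoid.NatLE (a * a⁻¹ * b) b := ⟨_, InverseMonoid.mul_inv_idem a, rfl⟩
    obtain ⟨c, hc1, hc2⟩ := FInverseMonoid.sigma_maxOf (a * a⁻¹ * b)
    apply InverseMonoid.NatLE.antisymm
    · exact FInverseMonoid.le_maxOf _ _ ⟨c, hc1.trans hle, hc2⟩
    · exact FInverseMonoid.le_maxOf _ _ ⟨_, InverseMonoid.NatLE.refl _, hle.trans (hself b)⟩

end FTerm

/-- The `F`-inverse monoid `FInv⟨Y | R⟩` given by generators `Y` and relations `R`. -/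
def FInv {Y : Type*} (R : Set (FTerm Y × FTerm Y)) : Type _ := Quotient (FTerm.setoid R)

namespace FInv

variable {Y : Type*} (R : Set (FTerm Y × FTerm Y))

/-- The element of `FInv⟨Y | R⟩` represented by a term. -/
def mk (t : FTerm Y) : FInv R := Quotient.mk (FTerm.setoid R) t

instance : Monoid (FInv R) where
  mul := Quotient.map₂ FTerm.mul fun _ _ h _ _ h' => FTerm.Congr.mul_congr h h'
  one := mk R FTerm.one
  mul_assoc := by
    rintro ⟨a⟩ ⟨b⟩ ⟨c⟩; exact Quotient.sound (FTerm.Congr.mul_assoc a b c)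
  one_mul := by rintro ⟨a⟩; exact Quotient.sound (FTerm.Congr.one_mul a)
  mul_one := by rintro ⟨a⟩; exact Quotient.sound (FTerm.Congr.mul_one a)

instance : Inv (FInv R) where
  inv := Quotient.map FTerm.inv fun _ _ h => FTerm.Congr.inv_congr h

theorem double_inv (a : FInv R) : a⁻¹⁻¹ = a := by
  obtain ⟨a⟩ := a; exact Quotient.sound (FTerm.Congr.inv_inv a)

theorem mul_inv_mul (a : FInv R) : a * a⁻¹ * a = a := by
  obtain ⟨a⟩ := a; exact Quotient.sound (FTerm.Congr.mul_inv_mul a)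

instance : InverseMonoid (FInv R) where
  mul_inv_mul := mul_inv_mul R
  inv_mul_inv a := by
    have := mul_inv_mul R a⁻¹
    rwa [double_inv] at this
  inv_unique := by
    refine InverseMonoid.unique_of_equations (double_inv R) ?_ (mul_inv_mul R) ?_
    · rintro ⟨a⟩ ⟨b⟩; exact Quotient.sound (FTerm.Congr.mul_inv_rev a b)
    · rintro ⟨a⟩ ⟨b⟩; exact Quotient.sound (FTerm.Congr.idem_comm a b)

/-- The operation `ᵐ` on `FInv⟨Y | R⟩` induced by that on terms. -/
def maxOf : FInv R → FInv R :=
  Quotient.map FTerm.maxOf fun _ _ h => FTerm.Congr.maxOf_congr h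

theorem natLE_maxOf (a : FInv R) : InverseMonoid.NatLE a (maxOf R a) := by
  refine ⟨a * a⁻¹, InverseMonoid.mul_inv_idem a, ?_⟩
  obtain ⟨a⟩ := a
  exact (Quotient.sound (FTerm.Congr.le_maxOf a)).symm

theorem maxOf_eq_of_natLE {a b : FInv R} (h : InverseMonoid.NatLE a b) :
    maxOf R a = maxOf R b := by
  rw [h.eq_mul]
  obtain ⟨a⟩ := a
  obtain ⟨b⟩ := b
  exact Quotient.sound (FTerm.Congr.maxOf_idem_mul a b)

instance : FInverseMonoid (FInv R) where
  maxOf := maxOf R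
  sigma_maxOf a := ⟨a, InverseMonoid.NatLE.refl a, natLE_maxOf R a⟩
  le_maxOf a b := by
    rintro ⟨c, h1, h2⟩
    rw [← maxOf_eq_of_natLE R h1, maxOf_eq_of_natLE R h2]
    exact natLE_maxOf R b

end FInv

/-- An `F`-inverse monoid is finitely presented if it is isomorphic, in the signature
`(·, 1, ⁻¹, ᵐ)`, to `FInv⟨Y | R⟩` for a finite set `Y` and a finite set `R` of relations. -/
def FInverseMonoid.IsFinitelyPresented (S : Type*) [FInverseMonoid S] : Prop :=
  ∃ (Y : Type) (_ : Finite Y) (R : Set (FTerm Y × FTerm Y)) (_ : R.Finite) (e : FInv R ≃* S),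
    (∀ a : FInv R, e a⁻¹ = (e a)⁻¹) ∧
    (∀ a : FInv R, e (FInverseMonoid.maxOf a) = FInverseMonoid.maxOf (e a))

/-- Words in `(X ∪ X⁻¹)*`; the letter `(x, true)` stands for `x` and `(x, false)` for `x⁻¹`. -/
abbrev InvWord (X : Type*) := FreeMonoid (X × Bool)

/-- The formal inverse of a word. -/
def InvWord.inv {X : Type*} (w : InvWord X) : InvWord X :=
  FreeMonoid.ofList (FreeGroup.invRev w.toList)

namespace FIM

/-- The defining relations of the free inverse monoid. -/
inductive Rel (X : Type*) : InvWord X → InvWord X → Prop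
  | mul_inv_mul (w : InvWord X) : Rel X (w * w.inv * w) w
  | idem_comm (w v : InvWord X) : Rel X ((w * w.inv) * (v * v.inv)) ((v * v.inv) * (w * w.inv))

/-- The Vagner congruence on `(X ∪ X⁻¹)*`. -/
def vagner (X : Type*) : Con (InvWord X) := conGen (Rel X)

end FIM

/-- The free inverse monoid on `X`. -/
def FIM (X : Type*) : Type _ := (FIM.vagner X).Quotient

namespace FIM

variable {X : Type*}

instance : Monoid (FIM X) := inferInstanceAs (Monoid (FIM.vagner X).Quotient)

/-- The element of the free inverse monoid represented by a word. -/
def mk : InvWord X →* FIM X := (FIM.vagner X).mk'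

theorem mk_surjective : Function.Surjective (mk (X := X)) := Con.mk'_surjective

theorem mk_eq {w v : InvWord X} : mk w = mk v ↔ vagner X w v := (vagner X).eq

theorem inv_mul_word (w v : InvWord X) : (w * v).inv = v.inv * w.inv := by
  apply FreeMonoid.toList.injective
  simp [InvWord.inv, FreeGroup.invRev, FreeMonoid.toList_mul]

theorem inv_inv_word (w : InvWord X) : w.inv.inv = w := by
  apply FreeMonoid.toList.injective
  simp [InvWord.inv, FreeGroup.invRev_invRev]

theorem vagner_inv {w v : InvWord X} (h : vagner X w v) : vagner X w.inv v.inv := by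
  replace h : ConGen.Rel (Rel X) w v := h
  induction h with
  | of _ _ h =>
    cases h with
    | mul_inv_mul w =>
      have this (a : InvWord X) := ConGen.Rel.of _ _ (Rel.mul_inv_mul a.inv)
      simp only [inv_mul_word, inv_inv_word, ← mul_assoc] at this ⊢
      exact this _
    | idem_comm w v =>
      have := ConGen.Rel.of _ _ (Rel.idem_comm v w)
      simp only [inv_mul_word, inv_inv_word] at this ⊢
      exact this
  | refl => exact (vagner X).refl _
  | symm _ ih => exact (vagner X).symm ih
  | trans _ _ ih1 ih2 => exact (vagner X).trans ih1 ih2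
  | mul _ _ ih1 ih2 =>
    rw [inv_mul_word, inv_mul_word]
    exact (vagner X).mul ih2 ih1

instance : Inv (FIM X) where
  inv := Quotient.map InvWord.inv fun _ _ h => vagner_inv h

theorem mk_inv (w : InvWord X) : mk w.inv = (mk w)⁻¹ := rfl

theorem double_inv (a : FIM X) : a⁻¹⁻¹ = a := by
  obtain ⟨w, rfl⟩ := mk_surjective a
  rw [← mk_inv, ← mk_inv, inv_inv_word]

theorem mul_inv_mul (a : FIM X) : a * a⁻¹ * a = a := by
  obtain ⟨w, rfl⟩ := mk_surjective a
  rw [← mk_inv, ← map_mul, ← map_mul, mk_eq]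
  exact ConGen.Rel.of _ _ (Rel.mul_inv_mul w)

instance : InverseMonoid (FIM X) where
  mul_inv_mul := mul_inv_mul
  inv_mul_inv a := by
    have := mul_inv_mul a⁻¹
    rwa [double_inv] at this
  inv_unique := by
    refine InverseMonoid.unique_of_equations double_inv ?_ mul_inv_mul ?_
    · intro a b
      obtain ⟨w, rfl⟩ := mk_surjective a
      obtain ⟨v, rfl⟩ := mk_surjective b
      rw [← map_mul, ← mk_inv, ← mk_inv, ← mk_inv, ← map_mul, inv_mul_word]
    · intro a b
      obtain ⟨w, rfl⟩ := mk_surjective a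
      obtain ⟨v, rfl⟩ := mk_surjective b
      simp only [← mk_inv, ← map_mul]
      rw [mk_eq]
      exact ConGen.Rel.of _ _ (Rel.idem_comm w v)

theorem freeGroup_mk_eq {w v : InvWord X} (h : vagner X w v) :
    FreeGroup.mk w.toList = FreeGroup.mk v.toList := by
  replace h : ConGen.Rel (Rel X) w v := h
  have hm : ∀ a b : InvWord X,
      FreeGroup.mk (a * b).toList = FreeGroup.mk a.toList * FreeGroup.mk b.toList := by
    intro a b; rw [FreeMonoid.toList_mul, FreeGroup.mul_mk]
  have hi : ∀ a : InvWord X, FreeGroup.mk a.inv.toList = (FreeGroup.mk a.toList)⁻¹ := by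
    intro a; rw [FreeGroup.inv_mk]; rfl
  induction h with
  | of _ _ h => cases h <;> simp only [hm, hi] <;> group
  | refl => rfl
  | symm _ ih => exact ih.symm
  | trans _ _ ih1 ih2 => exact ih1.trans ih2
  | mul _ _ ih1 ih2 => rw [hm, hm, ih1, ih2]

/-- The canonical map from the free inverse monoid to the free group. -/
def toFreeGroup : FIM X → FreeGroup X :=
  Quotient.lift (fun w : InvWord X => FreeGroup.mk w.toList) fun _ _ h => freeGroup_mk_eq h

theorem toFreeGroup_mk (w : InvWord X) : toFreeGroup (mk w) = FreeGroup.mk w.toList := rfl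

theorem toFreeGroup_mul (a b : FIM X) : toFreeGroup (a * b) = toFreeGroup a * toFreeGroup b := by
  obtain ⟨w, rfl⟩ := mk_surjective a
  obtain ⟨v, rfl⟩ := mk_surjective b
  rw [← map_mul]
  simp only [toFreeGroup_mk]
  rw [FreeMonoid.toList_mul, FreeGroup.mul_mk]

theorem toFreeGroup_eq_of_natLE {a b : FIM X} (h : InverseMonoid.NatLE a b) :
    toFreeGroup a = toFreeGroup b := by
  obtain ⟨e, he, rfl⟩ := h
  have h1 : toFreeGroup e * toFreeGroup e = toFreeGroup e := by rw [← toFreeGroup_mul, he.eq]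
  rw [toFreeGroup_mul, mul_eq_left.mp h1, one_mul]

open Classical in
/-- The element of the free inverse monoid represented by the freely reduced word `red(w)` of any
word `w` that represents `a`. -/
noncomputable def red (a : FIM X) : FIM X := mk (FreeMonoid.ofList (toFreeGroup a).toWord)

theorem natLE_of_red {L L' : List (X × Bool)} (h : FreeGroup.Red L L') :
    InverseMonoid.NatLE (mk (FreeMonoid.ofList L)) (mk (FreeMonoid.ofList L')) := by
  induction h with
  | refl => exact InverseMonoid.NatLE.refl _
  | tail _ h ih =>
    refine ih.trans ?_
    cases h with
    | @not L₁ L₂ x b =>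
      have h1 : FreeMonoid.ofList (L₁ ++ (x, b) :: (x, !b) :: L₂) =
          FreeMonoid.ofList L₁ * (FreeMonoid.of (x, b) * InvWord.inv (FreeMonoid.of (x, b))) *
            FreeMonoid.ofList L₂ := by
        apply FreeMonoid.toList.injective
        simp [FreeMonoid.toList_mul, InvWord.inv, FreeGroup.invRev]
      rw [h1, FreeMonoid.ofList_append]
      simp only [map_mul, mk_inv]
      exact InverseMonoid.natLE_insert_idem _ _ (InverseMonoid.mul_inv_idem _)

theorem natLE_red (a : FIM X) : InverseMonoid.NatLE a (red a) := by
  classical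
  obtain ⟨w, rfl⟩ := mk_surjective a
  have := natLE_of_red (FreeGroup.reduce.red (L := w.toList))
  rw [FreeMonoid.ofList_toList] at this
  rw [red, toFreeGroup_mk, FreeGroup.toWord_mk]
  convert this

/-- The free inverse monoid is `F`-inverse, with `wᵐ = red(w)`. -/
noncomputable instance : FInverseMonoid (FIM X) where
  maxOf := red
  sigma_maxOf a := ⟨a, InverseMonoid.NatLE.refl a, natLE_red a⟩
  le_maxOf a b := by
    rintro ⟨c, h1, h2⟩
    have : red a = red b := by
      rw [red, red, ← toFreeGroup_eq_of_natLE h1, toFreeGroup_eq_of_natLE h2]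
    rw [this]
    exact natLE_red b

end FIM

/-! Any finite set of relations true in `FIM X` also holds in an `F`-inverse monoid where some other
identity of `FIM X` fails. By Munn, an element of the free inverse monoid is a finite subtree of the
Cayley tree of the free group together with an end vertex. The idea is to weaken "subtree": for each
`n`, take pairs of a set of vertices and one of its elements, where the set need only contain the
geodesics between those of its points that are at distance at most `n`. These pairs form an
`F`-inverse monoid `ClosedExpansion (ShortPrefix X n)`, and `toExpansion n` maps `FIM X` to it.

This map commutes with `maxOf` on elements whose reduced word has length at most `n`
(`toExpansion_maxOf`). A term contains finitely many `maxOf`s, so its evaluation is preserved for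
all large `n` (`eventually_eval_toExpansion`), and a single `n` serves all of a finite `R`. In `FIM
X` every power of a generator `x` is fixed by `maxOf`. In the expansion this fails for the power `n
+ 1` (`toExpansion_pow_ne_maxOf`): the two-point set `{1, x ^ (n + 1)}` is already closed, its
points being too far apart. Hence this identity does not follow from `R`. -/

/-! ### Closed subsets of a group. -/

/-- A set is closed under `P` if, whenever it contains `g` and `g * h` and `P h p` holds, it
also contains `g * p`. -/
def IsClosedUnder {G : Type*} [Group G] (P : G → G → Prop) (A : Set G) : Prop :=
  ∀ g h p : G, P h p → g ∈ A → g * h ∈ A → g * p ∈ A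

/-- The least set containing `A` that is closed under `P`. -/
def closureUnder {G : Type*} [Group G] (P : G → G → Prop) (A : Set G) : Set G :=
  {g | ∀ B : Set G, IsClosedUnder P B → A ⊆ B → g ∈ B}

/-- Pairs of an element `g` of a group and a set closed under `P` that contains `1` and `g`. -/
@[ext]
structure ClosedExpansion {G : Type*} [Group G] (P : G → G → Prop) where
  carrier : Set G
  elem : G
  closed : IsClosedUnder P carrier
  one_mem : 1 ∈ carrier
  elem_mem : elem ∈ carrier

section Closure

variable {G : Type*} [Group G] {P : G → G → Prop}

theorem isClosedUnder_closureUnder (A : Set G) : IsClosedUnder P (closureUnder P A) :=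
  fun g h p hp hg hgh B hB hA => hB g h p hp (hg B hB hA) (hgh B hB hA)

theorem subset_closureUnder (A : Set G) : A ⊆ closureUnder P A :=
  fun _ hg _ _ hA => hA hg

theorem closureUnder_subset_iff {A B : Set G} (hB : IsClosedUnder P B) :
    closureUnder P A ⊆ B ↔ A ⊆ B :=
  ⟨(subset_closureUnder A).trans, fun h _ hg => hg B hB h⟩

/-- The closure condition compares `g`, `g * h` and `g * p` by right multiplication only, so left
translation preserves it. -/
theorem IsClosedUnder.preimage_mul_left {A : Set G} (hA : IsClosedUnder P A) (k : G) :
    IsClosedUnder P ((k * ·) ⁻¹' A) := by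
  intro g h p hp hg hgh
  simp only [Set.mem_preimage, ← mul_assoc] at *
  exact hA _ h p hp hg hgh

theorem IsClosedUnder.image_mul_left {A : Set G} (hA : IsClosedUnder P A) (k : G) :
    IsClosedUnder P ((k * ·) '' A) := by
  rw [Set.image_mul_left]
  exact hA.preimage_mul_left _

end Closure

/-! ### The `F`-inverse monoid of closed expansions. -/

namespace ClosedExpansion

variable {G : Type*} [Group G] {P : G → G → Prop}

/-- This is the product of Munn trees, followed by closure because a union of closed sets need not
be closed. -/
instance : Mul (ClosedExpansion P) where
  mul a b :=
    { carrier := closureUnder P (a.carrier ∪ (a.elem * ·) '' b.carrier)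
      elem := a.elem * b.elem
      closed := isClosedUnder_closureUnder _
      one_mem := subset_closureUnder _ (Or.inl a.one_mem)
      elem_mem := subset_closureUnder _ (Or.inr ⟨_, b.elem_mem, rfl⟩) }

/-- The pair of `g` and the least closed set containing `1` and `g`. -/
def greatest (P : G → G → Prop) (g : G) : ClosedExpansion P where
  carrier := closureUnder P {1, g}
  elem := g
  closed := isClosedUnder_closureUnder _
  one_mem := subset_closureUnder _ (by simp)
  elem_mem := subset_closureUnder _ (by simp)

/-- The closure of `{1}` may be larger than `{1}`, but it lies in every carrier, which makes it
neutral. -/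
instance : One (ClosedExpansion P) := ⟨greatest P 1⟩

instance : Inv (ClosedExpansion P) where
  inv a :=
    { carrier := (a.elem⁻¹ * ·) '' a.carrier
      elem := a.elem⁻¹
      closed := a.closed.image_mul_left _
      one_mem := ⟨_, a.elem_mem, by simp⟩
      elem_mem := ⟨_, a.one_mem, by simp⟩ }

theorem mul_elem (a b : ClosedExpansion P) : (a * b).elem = a.elem * b.elem := rfl

theorem one_elem : (1 : ClosedExpansion P).elem = 1 := rfl

theorem inv_elem (a : ClosedExpansion P) : a⁻¹.elem = a.elem⁻¹ := rfl

theorem inv_carrier (a : ClosedExpansion P) :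
    a⁻¹.carrier = (a.elem⁻¹ * ·) '' a.carrier := rfl

theorem mem_inv_carrier {a : ClosedExpansion P} {g : G} :
    g ∈ a⁻¹.carrier ↔ a.elem * g ∈ a.carrier := by
  rw [inv_carrier, Set.image_mul_left, inv_inv, Set.mem_preimage]

theorem left_subset_mul (a b : ClosedExpansion P) : a.carrier ⊆ (a * b).carrier :=
  fun _ h => subset_closureUnder _ (Or.inl h)

theorem right_mem_mul (a : ClosedExpansion P) {b : ClosedExpansion P} {g : G}
    (hg : g ∈ b.carrier) : a.elem * g ∈ (a * b).carrier :=
  subset_closureUnder _ (Or.inr ⟨g, hg, rfl⟩)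

theorem mul_carrier_subset {a b : ClosedExpansion P} {C : Set G} (hC : IsClosedUnder P C)
    (ha : a.carrier ⊆ C) (hb : ∀ g ∈ b.carrier, a.elem * g ∈ C) : (a * b).carrier ⊆ C := by
  refine (closureUnder_subset_iff hC).mpr (Set.union_subset ha ?_)
  rintro _ ⟨g, hg, rfl⟩
  exact hb g hg

theorem greatest_carrier_subset {g : G} {C : Set G} (hC : IsClosedUnder P C)
    (h1 : 1 ∈ C) (hg : g ∈ C) : (greatest P g).carrier ⊆ C :=
  (closureUnder_subset_iff hC).mpr (Set.insert_subset h1 (Set.singleton_subset_iff.mpr hg))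

/-- The universal property of the product's carrier, moved to a base point `k`. This form handles
nested products without computing translates of closures. -/
theorem mem_of_mem_mul {a b : ClosedExpansion P} (k : G) {C : Set G} (hC : IsClosedUnder P C)
    (ha : ∀ g ∈ a.carrier, k * g ∈ C) (hb : ∀ g ∈ b.carrier, k * a.elem * g ∈ C) :
    ∀ g ∈ (a * b).carrier, k * g ∈ C :=
  mul_carrier_subset (hC.preimage_mul_left k) ha
    fun g hg => by
      change k * (a.elem * g) ∈ C
      rw [← mul_assoc]
      exact hb g hg

instance : Monoid (ClosedExpansion P) where
  mul_assoc a b c := by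
    refine ClosedExpansion.ext (Set.Subset.antisymm ?_ ?_) (mul_assoc _ _ _)
    · refine mul_carrier_subset (closed _) (mul_carrier_subset (closed _) (left_subset_mul _ _)
        fun g hg => right_mem_mul _ (left_subset_mul _ _ hg)) fun g hg => ?_
      rw [mul_elem, mul_assoc]
      exact right_mem_mul _ (right_mem_mul _ hg)
    · refine mul_carrier_subset (closed _) ((left_subset_mul _ _).trans (left_subset_mul _ _))
        (mem_of_mem_mul _ (closed _) (fun g hg => left_subset_mul _ _ (right_mem_mul _ hg))
          fun g hg => ?_)
      exact right_mem_mul (a * b) hg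
  one_mul a := by
    refine ClosedExpansion.ext (Set.Subset.antisymm ?_ ?_) (one_mul _)
    · refine mul_carrier_subset a.closed (greatest_carrier_subset a.closed a.one_mem a.one_mem)
        fun g hg => ?_
      rwa [one_elem, one_mul]
    · intro g hg
      simpa only [one_elem, one_mul] using right_mem_mul 1 hg
  mul_one a := by
    refine ClosedExpansion.ext (Set.Subset.antisymm ?_ (left_subset_mul _ _)) (mul_one _)
    refine mul_carrier_subset a.closed subset_rfl
      (greatest_carrier_subset (a.closed.preimage_mul_left _) ?_ ?_) <;>
    · change a.elem * 1 ∈ a.carrier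
      rw [mul_one]
      exact a.elem_mem

theorem mul_inv_self (a : ClosedExpansion P) :
    (a * a⁻¹).carrier = a.carrier ∧ (a * a⁻¹).elem = 1 := by
  refine ⟨Set.Subset.antisymm ?_ (left_subset_mul _ _), mul_inv_cancel _⟩
  exact mul_carrier_subset a.closed subset_rfl fun g hg => mem_inv_carrier.mp hg

/-- An element over `1` multiplies on the left by joining its carrier to that of `b`, and here the
join adds nothing to `e.carrier`. -/
theorem mul_eq_of_subset {e b : ClosedExpansion P} (he : e.elem = 1)
    (h : b.carrier ⊆ e.carrier) : (e * b).carrier = e.carrier ∧ (e * b).elem = b.elem := by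
  refine ⟨Set.Subset.antisymm (mul_carrier_subset e.closed subset_rfl fun g hg => ?_)
    (left_subset_mul _ _), by rw [mul_elem, he, one_mul]⟩
  rw [he, one_mul]
  exact h hg

theorem mul_carrier_comm_subset {e f : ClosedExpansion P} (he : e.elem = 1) (hf : f.elem = 1) :
    (e * f).carrier ⊆ (f * e).carrier := by
  refine mul_carrier_subset (closed _) (fun g hg => ?_) fun g hg => ?_
  · simpa [hf] using right_mem_mul f hg
  · rw [he, one_mul]
    exact left_subset_mul _ _ hg

theorem mul_inv_rev_carrier_subset (a b : ClosedExpansion P) :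
    (b⁻¹ * a⁻¹).carrier ⊆ (a * b)⁻¹.carrier := by
  refine mul_carrier_subset (closed _) (fun g hg => ?_) fun g hg => ?_
  · rw [mem_inv_carrier] at hg ⊢
    rw [mul_elem, mul_assoc]
    exact right_mem_mul _ hg
  · rw [mem_inv_carrier] at hg ⊢
    rw [mul_elem, inv_elem, mul_assoc, mul_inv_cancel_left]
    exact left_subset_mul _ _ hg

theorem inv_inv_eq (a : ClosedExpansion P) : a⁻¹⁻¹ = a := by
  refine ClosedExpansion.ext (Set.ext fun g => ?_) (inv_inv _)
  rw [mem_inv_carrier, mem_inv_carrier, inv_elem, mul_inv_cancel_left]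

theorem mul_inv_mul_eq (a : ClosedExpansion P) : a * a⁻¹ * a = a := by
  obtain ⟨h1, h2⟩ := mul_inv_self a
  obtain ⟨h3, h4⟩ := mul_eq_of_subset h2 h1.ge
  exact ClosedExpansion.ext (h3.trans h1) h4

instance : InverseMonoid (ClosedExpansion P) where
  mul_inv_mul := mul_inv_mul_eq
  inv_mul_inv a := by simpa only [inv_inv_eq] using mul_inv_mul_eq a⁻¹
  inv_unique := by
    refine InverseMonoid.unique_of_equations inv_inv_eq (fun a b => ?_) mul_inv_mul_eq
      fun a b => ?_
    · refine ClosedExpansion.ext (Set.Subset.antisymm ?_ (mul_inv_rev_carrier_subset a b))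
        (mul_inv_rev _ _)
      intro g hg
      rw [mem_inv_carrier] at hg
      -- Translating by the inverse of the product's end point moves the base point there; the two
      -- factors then become the translates occurring in `b⁻¹ * a⁻¹`.
      have key : ∀ g ∈ (a * b).carrier, (a * b).elem⁻¹ * g ∈ (b⁻¹ * a⁻¹).carrier := by
        rw [mul_elem, mul_inv_rev]
        refine mem_of_mem_mul _ (closed _) (fun g hg => ?_) fun g hg => ?_
        · rw [mul_assoc]
          exact right_mem_mul b⁻¹ ⟨g, hg, rfl⟩
        · rw [inv_mul_cancel_right]
          exact left_subset_mul _ _ ⟨g, hg, rfl⟩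
      simpa using key _ hg
    · obtain ⟨-, ha⟩ := mul_inv_self a
      obtain ⟨-, hb⟩ := mul_inv_self b
      refine ClosedExpansion.ext (Set.Subset.antisymm (mul_carrier_comm_subset ha hb)
        (mul_carrier_comm_subset hb ha)) ?_
      rw [mul_elem (a * a⁻¹), mul_elem (b * b⁻¹), ha, hb]

/-- The idempotent `a * a⁻¹` keeps the carrier of `a` and has group component `1`; it absorbs the
least closed set through `1` and `a.elem`. -/
theorem natLE_greatest (a : ClosedExpansion P) : InverseMonoid.NatLE a (greatest P a.elem) := by
  refine ⟨a * a⁻¹, InverseMonoid.mul_inv_idem a, ?_⟩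
  obtain ⟨h1, h2⟩ := mul_inv_self a
  obtain ⟨h3, h4⟩ := mul_eq_of_subset (b := greatest P a.elem) h2
    (h1.symm ▸ greatest_carrier_subset a.closed a.one_mem a.elem_mem)
  exact ClosedExpansion.ext (h3.trans h1).symm h4.symm

/-- An idempotent has trivial group component. Thus `σ`-related elements share their group
component. -/
theorem elem_eq_of_natLE {a b : ClosedExpansion P} (h : InverseMonoid.NatLE a b) :
    a.elem = b.elem := by
  obtain ⟨e, he, rfl⟩ := h
  have h1 : e.elem * e.elem = e.elem := congrArg elem he.eq
  rw [mul_elem, mul_eq_left.mp h1, one_mul]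

/-- The closed sets of a group give rise to an `F`-inverse monoid. -/
instance : FInverseMonoid (ClosedExpansion P) where
  maxOf a := greatest P a.elem
  sigma_maxOf a := ⟨a, InverseMonoid.NatLE.refl a, natLE_greatest a⟩
  le_maxOf a b := by
    rintro ⟨c, h1, h2⟩
    rw [← elem_eq_of_natLE h1, elem_eq_of_natLE h2]
    exact natLE_greatest b

theorem maxOf_eq (a : ClosedExpansion P) : FInverseMonoid.maxOf a = greatest P a.elem := rfl

theorem greatest_inv (g : G) : greatest P g⁻¹ = (greatest P g)⁻¹ := by
  refine ClosedExpansion.ext (Set.Subset.antisymm ?_ ?_) rfl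
  · exact greatest_carrier_subset (closed _) (one_mem _) (elem_mem (greatest P g)⁻¹)
  · have key : (greatest P g).carrier ⊆ (g⁻¹ * ·) ⁻¹' (greatest P g⁻¹).carrier := by
      refine greatest_carrier_subset ((closed _).preimage_mul_left _) ?_ ?_
      · rw [Set.mem_preimage, mul_one]
        exact elem_mem (greatest P g⁻¹)
      · rw [Set.mem_preimage, inv_mul_cancel]
        exact one_mem _
    rintro _ ⟨h, hh, rfl⟩
    exact key hh

/-- The projection to the group. -/
def elemHom (P : G → G → Prop) : ClosedExpansion P →* G where
  toFun := elem
  map_one' := rfl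
  map_mul' _ _ := rfl

end ClosedExpansion

/-! ### Homomorphisms out of the free inverse monoid. -/

namespace FIM

variable {X : Type*}

theorem lift_word_inv {S : Type*} [InverseMonoid S] (f : X × Bool → S)
    (hf : ∀ x b, f (x, !b) = (f (x, b))⁻¹) (w : InvWord X) :
    FreeMonoid.lift f w.inv = (FreeMonoid.lift f w)⁻¹ := by
  induction w using FreeMonoid.inductionOn' with
  | one =>
    have : (1 : InvWord X).inv = 1 := rfl
    rw [this, map_one, InverseMonoid.idem_inv (one_mul 1)]
  | of_mul p w ih =>
    have : InvWord.inv (FreeMonoid.of p) = FreeMonoid.of (p.1, !p.2) := rfl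
    rw [inv_mul_word, map_mul, map_mul, ih, InverseMonoid.mul_inv_rev', this,
      FreeMonoid.lift_eval_of, FreeMonoid.lift_eval_of, hf]

/-- The homomorphism from the free inverse monoid induced by an assignment of the letters. -/
def lift {S : Type*} [InverseMonoid S] (f : X × Bool → S)
    (hf : ∀ x b, f (x, !b) = (f (x, b))⁻¹) : FIM X →* S :=
  (vagner X).lift (FreeMonoid.lift f) <| Con.conGen_le.mpr fun w v h => by
    rw [Con.ker_rel]
    cases h with
    | mul_inv_mul w =>
      simp only [map_mul, lift_word_inv f hf, InverseMonoid.mul_inv_mul]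
    | idem_comm w v =>
      simp only [map_mul, lift_word_inv f hf]
      exact InverseMonoid.idem_comm (InverseMonoid.mul_inv_idem _) (InverseMonoid.mul_inv_idem _)

end FIM

theorem InverseMonoid.map_inv_of_monoidHom {S T : Type*} [InverseMonoid S] [InverseMonoid T]
    (f : S →* T) (a : S) : f a⁻¹ = (f a)⁻¹ := by
  refine InverseMonoid.inv_unique _ _ ?_ ?_
  · rw [← map_mul, ← map_mul, InverseMonoid.mul_inv_mul]
  · rw [← map_mul, ← map_mul, InverseMonoid.inv_mul_inv]

/-! ### Truncated geodesic closure in the free group. -/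

namespace FIM

variable {X : Type*}

open Classical in
/-- `h` has length at most `n`, and `p` is a prefix of `h`. -/
def ShortPrefix (X : Type*) (n : ℕ) (h p : FreeGroup X) : Prop :=
  h.toWord.length ≤ n ∧ ∃ k, p = FreeGroup.mk (h.toWord.take k)

/-- The homomorphism from the free inverse monoid to the expansion of the free group by sets that
contain the geodesics between any two of their points at distance at most `n`. -/
def toExpansion (n : ℕ) : FIM X →* ClosedExpansion (ShortPrefix X n) :=
  lift (fun p => ClosedExpansion.greatest _ (FreeGroup.mk [p])) fun x b => by
    rw [← ClosedExpansion.greatest_inv, FreeGroup.inv_mk]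
    rfl

theorem toExpansion_mk_of (n : ℕ) (p : X × Bool) :
    toExpansion n (mk (FreeMonoid.of p)) = ClosedExpansion.greatest _ (FreeGroup.mk [p]) := rfl

theorem toExpansion_elem (n : ℕ) (a : FIM X) : (toExpansion n a).elem = toFreeGroup a := by
  obtain ⟨w, rfl⟩ := mk_surjective a
  rw [toFreeGroup_mk]
  induction w using FreeMonoid.inductionOn' with
  | one => rw [map_one, map_one]; rfl
  | of_mul p w ih =>
    rw [map_mul, map_mul, ClosedExpansion.mul_elem, ih, FreeMonoid.toList_mul,
      ← FreeGroup.mul_mk]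
    rfl

/-- The carrier is generated by the vertices of the path that `w` traces. The base point `g` varies
because the induction moves it along the first letter. -/
theorem mem_of_mem_toExpansion (n : ℕ) {C : Set (FreeGroup X)}
    (hC : IsClosedUnder (ShortPrefix X n) C) (w : InvWord X) (g : FreeGroup X)
    (h : ∀ k, g * FreeGroup.mk (w.toList.take k) ∈ C) :
    ∀ p ∈ (toExpansion n (mk w)).carrier, g * p ∈ C := by
  induction w using FreeMonoid.inductionOn' generalizing g with
  | one =>
    rw [map_one, map_one]
    refine ClosedExpansion.greatest_carrier_subset (hC.preimage_mul_left g) ?_ ?_ <;>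
    exact h 0
  | of_mul q w ih =>
    rw [map_mul, map_mul, toExpansion_mk_of]
    have hk : ∀ k, g * FreeGroup.mk [q] * FreeGroup.mk (w.toList.take k) ∈ C := fun k => by
      rw [mul_assoc, FreeGroup.mul_mk]
      exact h (k + 1)
    refine ClosedExpansion.mem_of_mem_mul g hC ?_ (ih _ hk)
    -- The prefixes of lengths `0` and `1` are the two ends of the first edge.
    exact ClosedExpansion.greatest_carrier_subset (hC.preimage_mul_left g) (h 0) (h 1)

-- When the reduced word is short, every closed set containing its two end points contains its whole
-- path, so the image of the reduced word has the least possible carrier.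
open Classical in
theorem toExpansion_maxOf {n : ℕ} {a : FIM X} (h : (toFreeGroup a).toWord.length ≤ n) :
    toExpansion n (FInverseMonoid.maxOf a) = FInverseMonoid.maxOf (toExpansion n a) := by
  have he : (toExpansion n (FInverseMonoid.maxOf a)).elem = toFreeGroup a := by
    rw [toExpansion_elem]
    exact (toFreeGroup_eq_of_natLE (natLE_red a)).symm
  rw [ClosedExpansion.maxOf_eq, toExpansion_elem]
  refine ClosedExpansion.ext (Set.Subset.antisymm ?_ ?_) he
  · intro p hp
    rw [← one_mul p]
    refine mem_of_mem_toExpansion n (ClosedExpansion.closed _) _ 1 (fun k => ?_) p hp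
    refine ClosedExpansion.closed _ 1 _ _ ⟨h, k, rfl⟩ (ClosedExpansion.one_mem _) ?_
    rw [one_mul]
    exact ClosedExpansion.elem_mem (ClosedExpansion.greatest _ (toFreeGroup a))
  · refine ClosedExpansion.greatest_carrier_subset (ClosedExpansion.closed _)
      (ClosedExpansion.one_mem _) ?_
    rw [← he]
    exact ClosedExpansion.elem_mem _

theorem eventually_eval_toExpansion {Y : Type*} (φ : Y → FIM X) (t : FTerm Y) :
    ∀ᶠ n in Filter.atTop,
      FTerm.eval (fun y => toExpansion n (φ y)) t = toExpansion n (FTerm.eval φ t) := by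
  classical
  induction t with
  | var y => exact Filter.Eventually.of_forall fun _ => rfl
  | one => exact Filter.Eventually.of_forall fun n => (map_one (toExpansion n)).symm
  | mul s t hs ht =>
    filter_upwards [hs, ht] with n hs ht
    simp only [FTerm.eval, hs, ht, map_mul]
  | inv t ht =>
    filter_upwards [ht] with n ht
    simp only [FTerm.eval, ht, InverseMonoid.map_inv_of_monoidHom]
  | maxOf t ht =>
    -- This `maxOf` is preserved once `n` reaches the reduced length of the value of its argument.
    filter_upwards [ht, Filter.eventually_ge_atTop (toFreeGroup (FTerm.eval φ t)).toWord.length]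
      with n ht hn
    rw [FTerm.eval, FTerm.eval, ht, toExpansion_maxOf hn]

-- A positive power of a letter is already freely reduced.
open Classical in
theorem maxOf_mk_pow (x : X) (n : ℕ) :
    FInverseMonoid.maxOf (mk (FreeMonoid.of (x, true)) ^ n) = mk (FreeMonoid.of (x, true)) ^ n := by
  have h : ∀ n : ℕ, mk (FreeMonoid.of (x, true)) ^ n =
      mk (FreeMonoid.ofList (List.replicate n (x, true))) := fun n => by
    induction n with
    | zero => rfl
    | succ n ih => rw [pow_succ', ih, ← map_mul]; rfl
  have hg : toFreeGroup (mk (FreeMonoid.of (x, true)) ^ n) = FreeGroup.of x ^ n := by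
    induction n with
    | zero => rfl
    | succ n ih => rw [pow_succ, pow_succ, toFreeGroup_mul, ih]; rfl
  change red _ = _
  rw [red, hg, FreeGroup.toWord_of_pow, h]

-- The power passes through the vertex `x`, whereas the greatest element over `x ^ (n + 1)` has only
-- its two end points in its carrier.
open Classical in
theorem toExpansion_pow_ne_maxOf (x : X) {n : ℕ} (hn : 1 ≤ n) :
    FInverseMonoid.maxOf (toExpansion n (mk (FreeMonoid.of (x, true))) ^ (n + 1)) ≠
      toExpansion n (mk (FreeMonoid.of (x, true))) ^ (n + 1) := by
  intro heq
  have hlen : ∀ k : ℕ, (FreeGroup.of x ^ k).toWord.length = k := fun k => by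
    rw [FreeGroup.toWord_of_pow, List.length_replicate]
  have helem : (toExpansion n (mk (FreeMonoid.of (x, true))) ^ (n + 1)).elem =
      FreeGroup.of x ^ (n + 1) :=
    map_pow (ClosedExpansion.elemHom (ShortPrefix X n))
      (toExpansion n (mk (FreeMonoid.of (x, true)))) (n + 1)
  have hx : FreeGroup.of x ∈
      (toExpansion n (mk (FreeMonoid.of (x, true))) ^ (n + 1)).carrier := by
    rw [pow_succ']
    exact ClosedExpansion.left_subset_mul _ _
      (toExpansion n (mk (FreeMonoid.of (x, true)))).elem_mem
  rw [← heq, ClosedExpansion.maxOf_eq, helem] at hx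
  have hclosed : IsClosedUnder (ShortPrefix X n) {1, FreeGroup.of x ^ (n + 1)} := by
    rintro g h p ⟨hh, k, rfl⟩ hg hgh
    -- The two points are at distance `n + 1`, so a step of length at most `n` between points of the
    -- set is trivial, and so are its prefixes.
    have h1 : h = 1 := by
      by_contra hne
      have hl := hlen (n + 1)
      rcases hg with rfl | rfl <;> rcases hgh with hgh | hgh
      · exact hne (by simpa using hgh)
      · rw [one_mul, Set.mem_singleton_iff] at hgh
        rw [hgh] at hh
        omega
      · rw [mul_eq_one_iff_inv_eq] at hgh
        rw [← hgh, FreeGroup.toWord_inv, FreeGroup.invRev_length] at hh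
        omega
      · exact hne (by simpa using hgh)
    subst h1
    simpa [← FreeGroup.one_eq_mk] using hg
  rcases ClosedExpansion.greatest_carrier_subset hclosed (by simp) (by simp) hx with h | h
  · have := hlen 1
    rw [pow_one, h] at this
    simp at this
  · have h1 := hlen 1
    rw [pow_one, Set.mem_singleton_iff.mp h, hlen] at h1
    -- Here `n ≥ 1` is needed: for `n = 0` the far end point would be `x` itself.
    omega

end FIM

/-! ### Evaluation of terms and the contradiction. -/

/-- Powers of a term. -/
def FTerm.pow {Y : Type*} (t : FTerm Y) : ℕ → FTerm Y
  | 0 => one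
  | n + 1 => mul (t.pow n) t

theorem FTerm.eval_pow {Y S : Type*} [FInverseMonoid S] (φ : Y → S) (t : FTerm Y) (n : ℕ) :
    eval φ (t.pow n) = eval φ t ^ n := by
  induction n with
  | zero => rw [pow_zero]; rfl
  | succ n ih => rw [pow_succ, ← ih]; rfl

theorem FInv.map_mk_eq_eval {Y S : Type*} [FInverseMonoid S] {R : Set (FTerm Y × FTerm Y)}
    (e : FInv R →* S) (hm : ∀ a, e (FInverseMonoid.maxOf a) = FInverseMonoid.maxOf (e a))
    (t : FTerm Y) : e (mk R t) = FTerm.eval (fun y => e (mk R (FTerm.var y))) t := by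
  induction t with
  | var y => rfl
  | one => exact map_one e
  | mul s t hs ht => rw [FTerm.eval, ← hs, ← ht, ← map_mul]; rfl
  | inv t ht => rw [FTerm.eval, ← ht, ← InverseMonoid.map_inv_of_monoidHom]; rfl
  | maxOf t ht => rw [FTerm.eval, ← ht, ← hm]; rfl

/-- The free inverse monoid on a nonempty set is not finitely presented as an `F`-inverse
monoid. -/
theorem mainTheorem6 (X : Type*) [Nonempty X] :
    ¬ FInverseMonoid.IsFinitelyPresented (FIM X) := by
  rintro ⟨Y, -, R, hR, e, -, hm⟩
  obtain ⟨x⟩ := ‹Nonempty X›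
  set a : FIM X := FIM.mk (FreeMonoid.of (x, true)) with ha
  set φ : Y → FIM X := fun y => e (FInv.mk R (FTerm.var y)) with hφ
  have heval : ∀ t, e (FInv.mk R t) = FTerm.eval φ t := FInv.map_mk_eq_eval e.toMonoidHom hm
  obtain ⟨t, ht⟩ : ∃ t, FTerm.eval φ t = a := by
    obtain ⟨t, ht⟩ := Quotient.exists_rep (e.symm a)
    refine ⟨t, ?_⟩
    rw [← heval, FInv.mk, ht, e.apply_symm_apply]
  have hrel : ∀ᶠ n in Filter.atTop, ∀ p ∈ R,
      FTerm.eval (fun y => FIM.toExpansion n (φ y)) p.1 =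
        FTerm.eval (fun y => FIM.toExpansion n (φ y)) p.2 := by
    rw [Filter.eventually_all_finite hR]
    intro p hp
    filter_upwards [FIM.eventually_eval_toExpansion φ p.1,
      FIM.eventually_eval_toExpansion φ p.2] with n h1 h2
    rw [h1, h2, ← heval, ← heval]
    -- The relation holds in `FIM X` under `φ`, and `toExpansion n` carries it over because both
    -- sides are evaluated compatibly.
    exact congrArg _ (congrArg e (Quotient.sound (FTerm.Congr.of hp)))
  obtain ⟨n, hn, hnt, h1⟩ := (hrel.and ((FIM.eventually_eval_toExpansion φ t).and
    (Filter.eventually_ge_atTop 1))).exists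
  -- The identity holds in `FIM X`, so injectivity of `e` makes it a consequence of `R`; soundness
  -- would then force it in the `n`-th expansion.
  have hcongr : FTerm.Congr R (FTerm.maxOf (t.pow (n + 1))) (t.pow (n + 1)) := by
    refine Quotient.exact (s := FTerm.setoid R) (e.injective ?_)
    refine (heval _).trans (Eq.trans ?_ (heval _).symm)
    rw [FTerm.eval, FTerm.eval_pow, ht, ha, FIM.maxOf_mk_pow]
  have := hcongr.eval_eq _ hn
  rw [FTerm.eval, FTerm.eval_pow, hnt, ht] at this
  exact FIM.toExpansion_pow_ne_maxOf x h1 this
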